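/- Theorem (Optimality conditions for Wasserstein medians). Let $(\mathcal X,d)$ be a proper metric space, i.e. a metric space in which closed balls are compact. Let $\mathcal P_1(\mathcal X)$ be the set of Borel probability measures $\mu$ on $\mathcal X$ with finite first moment, i.e. $\int_{\mathcal X} d(x_0,x)\,d\mu(x)<\infty$ for some (equivalently, all) $x_0\in\mathcal X$, and for $\mu,\mu'\in\mathcal P_1(\mathcal X)$ let $$W_1(\mu,\mu')=\inf_{\gamma\in\Pi(\mu,\mu')}\int_{\mathcal X^2} d(x,y)\,d\gamma(x,y),$$ where $\Pi(\mu,\mu')$ is the set of Borel probability measures on $\mathcal X^2$ with marginals $\mu$ and $\mu'$. Let $N\ge 1$, let $\nu_1,\dots,\nu_N\in\mathcal P_1(\mathcal X)$, let $\lambda_1,\dots,\lambda_N>0$ with $\sum_{i=1}^N\lambda_i=1$, and let $\nu\in\mathcal P_1(\mathcal X)$. Then $\nu$ is a Wasserstein median of $(\nu_1,\dots,\nu_N)$ with weights $(\lambda_1,\dots,\lambda_N)$, i.e. a minimizer of $\mu\mapsto\sum_{i=1}^N\lambda_i W_1(\nu_i,\mu)$ over $\mathcal P_1(\mathcal X)$,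 if and only if there exist functions $\psi_1,\dots,\psi_N:\mathcal X\to\mathbb R$ such that 1. for every $i=1,\dots,N$, $\psi_i$ is $1$-Lipschitz and is a Kantorovich potential between $\nu_i$ and $\nu$, i.e. $$W_1(\nu_i,\nu)=\int_{\mathcal X}\psi_i\,d\nu_i-\int_{\mathcal X}\psi_i\,d\nu;$$ 2. $\sum_{i=1}^N\lambda_i\psi_i\le 0$ on $\mathcal X$, and $\sum_{i=1}^N\lambda_i\psi_i=0$ on $\operatorname{spt}(\nu)$, the support of $\nu$. -/

import Mathlib

open MeasureTheory

namespace WassersteinMedian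

noncomputable section

/-- Borel probability measures with finite first moment: the distance to some point `x₀`
(equivalently, by the triangle inequality, to every point) is integrable. -/
def FiniteFirstMoment (X : Type*) [MetricSpace X] [MeasurableSpace X] : Type _ :=
  {μ : ProbabilityMeasure X // ∃ x₀ : X, Integrable (fun x => dist x₀ x) (μ : Measure X)}

/-- The Borel measure underlying an element of `FiniteFirstMoment X`. -/
def FiniteFirstMoment.toMeasure {X : Type*} [MetricSpace X] [MeasurableSpace X]
    (μ : FiniteFirstMoment X) : Measure X :=
  (μ.1 : Measure X)

/-- Transport plans between `μ` and `ν`: Borel probability measures on `X × X` with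
marginals `μ` and `ν`. -/
def transportPlans {X : Type*} [MetricSpace X] [MeasurableSpace X]
    (μ ν : FiniteFirstMoment X) : Set (ProbabilityMeasure (X × X)) :=
  {γ | (γ : Measure (X × X)).map Prod.fst = μ.toMeasure ∧
    (γ : Measure (X × X)).map Prod.snd = ν.toMeasure}

/-- The Wasserstein distance of order one, as the infimum of the transport cost. On a proper
space the distance is integrable for every plan between measures with finite first moment, and
the product plan exists, so this is a genuine infimum of a nonempty set of nonnegative reals. -/
def W1 {X : Type*} [MetricSpace X] [MeasurableSpace X] (μ ν : FiniteFirstMoment X) : ℝ :=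
  sInf ((fun γ : ProbabilityMeasure (X × X) =>
    ∫ p, dist p.1 p.2 ∂(γ : Measure (X × X))) '' transportPlans μ ν)

/-- The weighted dispersion functional `μ ↦ ∑ i, w i * W1 (ν i) μ`. -/
def dispersion {X : Type*} [MetricSpace X] [MeasurableSpace X] {N : ℕ}
    (w : Fin N → ℝ) (ν : Fin N → FiniteFirstMoment X) (μ : FiniteFirstMoment X) : ℝ :=
  ∑ i, w i * W1 (ν i) μ

/-- The set of Wasserstein medians: minimizers of the weighted dispersion functional. -/
def medians {X : Type*} [MetricSpace X] [MeasurableSpace X] {N : ℕ}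
    (w : Fin N → ℝ) (ν : Fin N → FiniteFirstMoment X) : Set (FiniteFirstMoment X) :=
  {μ | ∀ μ' : FiniteFirstMoment X, dispersion w ν μ ≤ dispersion w ν μ'}

/-- A 1-Lipschitz function `ψ` is a Kantorovich potential between `μ` and `ν` if
`W1 μ ν = ∫ ψ dμ - ∫ ψ dν`. (Lipschitz functions are integrable against measures with finite
first moment.) -/
def IsKantorovichPotential {X : Type*} [MetricSpace X] [MeasurableSpace X]
    (ψ : X → ℝ) (μ ν : FiniteFirstMoment X) : Prop :=
  LipschitzWith 1 ψ ∧ W1 μ ν = (∫ x, ψ x ∂μ.toMeasure) - ∫ x, ψ x ∂ν.toMeasure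

end

end WassersteinMedian

namespace WassersteinMedian

section

variable {X : Type*} [MetricSpace X] [MeasurableSpace X]

/-! The two conditions are complementary slackness for the dual problem: maximize `∑ i, w i * ∫ ψ i
dν i` over 1-Lipschitz `ψ i` with `∑ i, w i * ψ i ≤ 0`. Weak duality (`integral_sub_integral_le_W1`)
bounds every dispersion below by the dual value, and the conditions make `ν₀` reach that bound.

Conversely, a median needs dual potentials with no gap (`exists_dual_potentials_of_mem_medians`).
Kantorovich–Rubinstein duality (`W1_le_of_forall_lipschitz`) turns minimal dispersion into a min-max
over measures and Lipschitz tuples. Tuples vanishing at a base point are compact for pointwise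
convergence, so `exists_forall_le_of_convexCombo` exchanges the two, testing only finite
combinations of Dirac masses.

Kantorovich–Rubinstein duality is itself proved by Hahn–Banach for finitely supported measures, then
quantization. Properness enters through second countability. -/

instance (μ : FiniteFirstMoment X) : IsProbabilityMeasure μ.toMeasure :=
  inferInstanceAs (IsProbabilityMeasure (μ.1 : Measure X))

theorem FiniteFirstMoment.nonempty (μ : FiniteFirstMoment X) : Nonempty X :=
  μ.2.nonempty

/-! ### Transport plans and weak duality -/

section Plans

variable {μ ν : FiniteFirstMoment X} {γ : ProbabilityMeasure (X × X)}

theorem integrable_comp_fst_of_mem_transportPlans (hγ : γ ∈ transportPlans μ ν) {f : X → ℝ}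
    (hf : Integrable f μ.toMeasure) :
    Integrable (fun z : X × X => f z.1) (γ : Measure (X × X)) := by
  rw [← hγ.1] at hf
  exact hf.comp_measurable measurable_fst

theorem integrable_comp_snd_of_mem_transportPlans (hγ : γ ∈ transportPlans μ ν) {f : X → ℝ}
    (hf : Integrable f ν.toMeasure) :
    Integrable (fun z : X × X => f z.2) (γ : Measure (X × X)) := by
  rw [← hγ.2] at hf
  exact hf.comp_measurable measurable_snd

theorem integral_comp_fst_of_mem_transportPlans (hγ : γ ∈ transportPlans μ ν) {f : X → ℝ}
    (hf : Integrable f μ.toMeasure) :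
    ∫ z, f z.1 ∂(γ : Measure (X × X)) = ∫ x, f x ∂μ.toMeasure := by
  rw [← hγ.1] at hf ⊢
  exact (integral_map measurable_fst.aemeasurable hf.aestronglyMeasurable).symm

theorem integral_comp_snd_of_mem_transportPlans (hγ : γ ∈ transportPlans μ ν) {f : X → ℝ}
    (hf : Integrable f ν.toMeasure) :
    ∫ z, f z.2 ∂(γ : Measure (X × X)) = ∫ x, f x ∂ν.toMeasure := by
  rw [← hγ.2] at hf ⊢
  exact (integral_map measurable_snd.aemeasurable hf.aestronglyMeasurable).symm

theorem W1_le_of_mem_transportPlans (hγ : γ ∈ transportPlans μ ν) :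
    W1 μ ν ≤ ∫ z, dist z.1 z.2 ∂(γ : Measure (X × X)) := by
  refine csInf_le ⟨0, ?_⟩ ⟨γ, hγ, rfl⟩
  rintro _ ⟨γ', -, rfl⟩
  exact integral_nonneg fun _ => dist_nonneg

variable (μ ν) in
theorem transportPlans_nonempty : (transportPlans μ ν).Nonempty :=
  ⟨⟨μ.toMeasure.prod ν.toMeasure, inferInstance⟩,
    (Measure.map_fst_prod).trans (by simp), (Measure.map_snd_prod).trans (by simp)⟩

end Plans

variable [BorelSpace X]

theorem FiniteFirstMoment.integrable_of_lipschitz (μ : FiniteFirstMoment X) {ψ : X → ℝ} (hψ : LipschitzWith 1 ψ) :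
    Integrable ψ μ.toMeasure := by
  obtain ⟨x₀, hx₀⟩ := μ.2
  have hx₀ : Integrable (fun x => dist x₀ x) μ.toMeasure := hx₀
  refine (hx₀.add (integrable_const ‖ψ x₀‖)).mono' hψ.continuous.aestronglyMeasurable ?_
  refine Filter.Eventually.of_forall fun x => ?_
  have h := hψ.dist_le_mul x x₀
  rw [NNReal.coe_one, one_mul, dist_comm x, Real.dist_eq] at h
  simp only [Pi.add_apply, Real.norm_eq_abs]
  linarith [abs_sub_abs_le_abs_sub (ψ x) (ψ x₀)]

theorem FiniteFirstMoment.integrable_dist (μ : FiniteFirstMoment X) (x₀ : X) : Integrable (fun x => dist x x₀) μ.toMeasure :=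
  μ.integrable_of_lipschitz (LipschitzWith.dist_left x₀)

variable [SecondCountableTopology X]

section Plans

variable {μ ν : FiniteFirstMoment X} {γ : ProbabilityMeasure (X × X)}

theorem integrable_dist_of_mem_transportPlans (hγ : γ ∈ transportPlans μ ν) :
    Integrable (fun z : X × X => dist z.1 z.2) (γ : Measure (X × X)) := by
  obtain ⟨x₀⟩ := μ.nonempty
  refine ((integrable_comp_fst_of_mem_transportPlans hγ (μ.integrable_dist x₀)).add
    (integrable_comp_snd_of_mem_transportPlans hγ (ν.integrable_dist x₀))).mono'
    continuous_dist.aestronglyMeasurable (Filter.Eventually.of_forall fun z => ?_)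
  rw [Real.norm_of_nonneg dist_nonneg]
  exact dist_triangle_right _ _ _

end Plans

/-- Weak Kantorovich duality. -/
theorem integral_sub_integral_le_W1 (μ ν : FiniteFirstMoment X) {ψ : X → ℝ}
    (hψ : LipschitzWith 1 ψ) :
    ∫ x, ψ x ∂μ.toMeasure - ∫ x, ψ x ∂ν.toMeasure ≤ W1 μ ν := by
  refine le_csInf ((transportPlans_nonempty μ ν).image _) ?_
  rintro _ ⟨γ, hγ, rfl⟩
  have hμ := μ.integrable_of_lipschitz hψ
  have hν := ν.integrable_of_lipschitz hψ
  rw [← integral_comp_fst_of_mem_transportPlans hγ hμ,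
    ← integral_comp_snd_of_mem_transportPlans hγ hν,
    ← integral_sub (integrable_comp_fst_of_mem_transportPlans hγ hμ)
      (integrable_comp_snd_of_mem_transportPlans hγ hν)]
  refine integral_mono ((integrable_comp_fst_of_mem_transportPlans hγ hμ).sub
    (integrable_comp_snd_of_mem_transportPlans hγ hν))
    (integrable_dist_of_mem_transportPlans hγ) fun z => ?_
  have h := hψ.dist_le_mul z.1 z.2
  rw [NNReal.coe_one, one_mul, Real.dist_eq] at h
  exact (le_abs_self _).trans h

/-! ### Quantization -/

/-- Finite measurable quantizations of a separable metric space, converging to the identity in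
mean for every measure with finite first moment. -/
theorem exists_quantization (X : Type*) [MetricSpace X] [MeasurableSpace X] [BorelSpace X]
    [SecondCountableTopology X] [Nonempty X] :
    ∃ (e : ℕ → X) (t : ∀ n : ℕ, X → Fin (n + 1)), (∀ n, Measurable (t n)) ∧
      ∀ μ : FiniteFirstMoment X, Filter.Tendsto
        (fun n => ∫ x, dist x (e (t n x)) ∂μ.toMeasure) Filter.atTop (nhds 0) := by
  let e := TopologicalSpace.denseSeq X
  refine ⟨e, fun n x => ⟨SimpleFunc.nearestPtInd e n x,
    Nat.lt_succ_of_le (SimpleFunc.nearestPtInd_le e n x)⟩, fun n => ?_, fun μ => ?_⟩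
  · refine measurable_to_countable' fun j => ?_
    convert (SimpleFunc.nearestPtInd e n).measurableSet_fiber (j : ℕ) using 1
    ext x
    simp [Fin.ext_iff]
  · have hlim : ∀ x, Filter.Tendsto (fun n => dist x (SimpleFunc.nearestPt e n x)) Filter.atTop
        (nhds 0) := fun x => by
      have h := SimpleFunc.tendsto_nearestPt (e := e) (x := x)
        (by rw [(TopologicalSpace.denseRange_denseSeq X).closure_range]; trivial)
      simpa using (tendsto_const_nhds (x := x)).dist h
    rw [← integral_zero X ℝ (μ := μ.toMeasure)]
    -- The nearest point among `e 0, …, e n` is no farther from `x` than `e 0`, which gives the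
    -- dominating function.
    refine tendsto_integral_of_dominated_convergence (fun x => dist x (e 0)) (fun n => ?_)
      (μ.integrable_dist (e 0)) (fun n => Filter.Eventually.of_forall fun x => ?_)
      (Filter.Eventually.of_forall hlim)
    · exact (measurable_id.dist (SimpleFunc.nearestPt e n).measurable).aestronglyMeasurable
    · rw [Real.norm_of_nonneg dist_nonneg, dist_comm x (e 0), dist_comm x]
      have h := SimpleFunc.edist_nearestPt_le e x (Nat.zero_le n)
      rw [edist_dist, edist_dist] at h
      exact (ENNReal.ofReal_le_ofReal_iff dist_nonneg).1 h

section Quantization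

variable {ι : Type*} [Fintype ι] [MeasurableSpace ι] [MeasurableSingletonClass ι]

theorem integral_comp_of_fintype {Y : Type*} [MeasurableSpace Y] (μ : Measure Y)
    [IsFiniteMeasure μ] {t : Y → ι} (ht : Measurable t) (f : ι → ℝ) :
    ∫ x, f (t x) ∂μ = ∑ j, μ.real (t ⁻¹' {j}) * f j := by
  rw [← integral_map ht.aemeasurable (by fun_prop), integral_fintype .of_finite]
  simp [map_measureReal_apply ht]

theorem integrable_comp_of_fintype {Y : Type*} [MeasurableSpace Y]
    (μ : Measure Y) [IsFiniteMeasure μ] {t : Y → ι} (ht : Measurable t) (f : ι → ℝ) :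
    Integrable (fun x => f (t x)) μ :=
  Integrable.comp_measurable (g := f) .of_finite ht

theorem FiniteFirstMoment.integrable_dist_comp (μ : FiniteFirstMoment X) {t : X → ι}
    (ht : Measurable t) (e : ι → X) : Integrable (fun x => dist x (e (t x))) μ.toMeasure := by
  obtain ⟨x₀⟩ := μ.nonempty
  refine ((μ.integrable_dist x₀).add (integrable_comp_of_fintype μ.toMeasure ht
    fun j => dist (e j) x₀)).mono' ?_ (Filter.Eventually.of_forall fun x => ?_)
  · exact (measurable_id.dist ((measurable_of_finite e).comp ht)).aestronglyMeasurable
  · rw [Real.norm_of_nonneg dist_nonneg]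
    exact dist_triangle_right _ _ _

/-- The bound does not depend on `ψ`; this uniformity serves both the duality theorem and the
continuity of integrals on Lipschitz tuples. -/
theorem FiniteFirstMoment.abs_integral_sub_sum_le (μ : FiniteFirstMoment X) {t : X → ι}
    (ht : Measurable t) (e : ι → X) {ψ : X → ℝ} (hψ : LipschitzWith 1 ψ) :
    |∫ x, ψ x ∂μ.toMeasure - ∑ j, μ.toMeasure.real (t ⁻¹' {j}) * ψ (e j)| ≤
      ∫ x, dist x (e (t x)) ∂μ.toMeasure := by
  rw [← integral_comp_of_fintype μ.toMeasure ht fun j => ψ (e j),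
    ← integral_sub (μ.integrable_of_lipschitz hψ)
      (integrable_comp_of_fintype μ.toMeasure ht fun j => ψ (e j))]
  rw [← Real.norm_eq_abs]
  refine norm_integral_le_of_norm_le (μ.integrable_dist_comp ht e)
    (Filter.Eventually.of_forall fun x => ?_)
  have h := hψ.dist_le_mul x (e (t x))
  rwa [NNReal.coe_one, one_mul, dist_eq_norm] at h

end Quantization

end

/-! ### Kantorovich–Rubinstein duality -/

/-- Kantorovich duality for finitely supported measures: if every 1-Lipschitz function has mean
difference at most `S`, then some coupling has cost at most `S`. -/
theorem exists_coupling_of_forall_lipschitz {X ι : Type*} [MetricSpace X] [Fintype ι]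
    (e : ι → X) {p q : ι → ℝ} (hp : p ∈ stdSimplex ℝ ι) (hq : q ∈ stdSimplex ℝ ι) {S : ℝ}
    (h : ∀ ψ : X → ℝ, LipschitzWith 1 ψ → ∑ j, p j * ψ (e j) - ∑ j, q j * ψ (e j) ≤ S) :
    ∃ g : ι × ι → ℝ, (∀ z, 0 ≤ g z) ∧ (∀ j, ∑ k, g (j, k) = p j) ∧
      (∀ k, ∑ j, g (j, k) = q k) ∧ ∑ z, g z * dist (e z.1) (e z.2) ≤ S := by
  classical
  by_contra! hcon
  -- `A` records both marginals and the cost. Without a good coupling, the compact image of the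
  -- simplex misses the closed set `{p} × {q} × (-∞, S]`, so a functional separates them.
  let A : (ι × ι → ℝ) →ₗ[ℝ] (ι → ℝ) × (ι → ℝ) × ℝ :=
    { toFun := fun g => (fun j => ∑ k, g (j, k), fun k => ∑ j, g (j, k),
        ∑ z, g z * dist (e z.1) (e z.2))
      map_add' := fun g g' => by
        ext <;> simp [Finset.sum_add_distrib, add_mul]
      map_smul' := fun c g => by
        ext <;> simp [Finset.mul_sum, mul_assoc] }
  have hAc : Continuous A := A.continuous_of_finiteDimensional
  obtain ⟨f, u, v, hfs, huv, hft⟩ := geometric_hahn_banach_compact_closed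
    (s := A '' stdSimplex ℝ (ι × ι)) (t := {p} ×ˢ ({q} ×ˢ Set.Iic S))
    ((convex_stdSimplex ℝ _).linear_image A) ((isCompact_stdSimplex ℝ _).image hAc)
    ((convex_singleton p).prod ((convex_singleton q).prod (convex_Iic S)))
    (isClosed_singleton.prod (isClosed_singleton.prod isClosed_Iic)) (by
      rw [Set.disjoint_left]
      rintro _ ⟨g, hg, rfl⟩ ⟨h1, h2, h3⟩
      exact (hcon g hg.1 (congrFun h1) (congrFun h2)).not_ge h3)
  set φ : ι → ℝ := fun j => f (Pi.single j 1, 0, 0) with hφ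
  set χ : ι → ℝ := fun j => f (0, Pi.single j 1, 0) with hχ
  set r : ℝ := f (0, 0, 1) with hr
  have hf : ∀ a b c, f (a, b, c) = ∑ j, a j * φ j + ∑ j, b j * χ j + c * r := fun a b c => by
    have h1 : (a, b, c) = ∑ j, a j • ((Pi.single j 1, 0, 0) : (ι → ℝ) × (ι → ℝ) × ℝ)
        + ∑ j, b j • ((0, Pi.single j 1, 0) : (ι → ℝ) × (ι → ℝ) × ℝ)
        + c • ((0, 0, 1) : (ι → ℝ) × (ι → ℝ) × ℝ) := by
      ext <;> simp [Prod.fst_sum, Prod.snd_sum, Finset.sum_apply, Pi.single_apply]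
    rw [h1]
    simp only [map_add, map_sum, map_smul, smul_eq_mul, hφ, hχ, hr]
  have hv : ∀ s ≤ S, v < ∑ j, p j * φ j + ∑ j, q j * χ j + s * r := fun s hs => by
    rw [← hf]; exact hft _ ⟨rfl, rfl, hs⟩
  have hu : ∀ j k, φ j + χ k + dist (e j) (e k) * r < u := fun j k => by
    have := hfs _ ⟨Pi.single (j, k) 1, single_mem_stdSimplex ℝ _, rfl⟩
    have hA : A (Pi.single (j, k) 1) = (Pi.single j 1, Pi.single k 1, dist (e j) (e k)) := by
      ext l
      · simp only [A, LinearMap.coe_mk, AddHom.coe_mk, Pi.single_apply, Prod.mk.injEq, ite_and]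
        by_cases hl : l = j <;> simp [hl]
      · simp only [A, LinearMap.coe_mk, AddHom.coe_mk, Pi.single_apply, Prod.mk.injEq, ite_and]
        by_cases hl : l = k <;> simp [hl]
      · simp [A, Pi.single_apply]
    rw [hA, hf] at this
    simpa [Pi.single_apply] using this
  set P := ∑ j, p j * φ j
  set Q := ∑ j, q j * χ j
  -- The cost coordinate of the target is unbounded below, so a positive `r` would push `f` below
  -- `v`.
  have hr0 : r ≤ 0 := by
    by_contra! hr0
    have h1 := hv (min S ((u - P - Q) / r)) (min_le_left _ _)
    have h2 : min S ((u - P - Q) / r) * r ≤ u - P - Q := by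
      rw [← le_div_iff₀ hr0]; exact min_le_right _ _
    linarith
  have hne : Nonempty ι := by
    by_contra hι
    rw [not_nonempty_iff] at hι
    simpa using hp.2
  -- If `r = 0`, averaging `φ j + χ k < u` against `p` and `q` gives `P + Q ≤ u < v`, a
  -- contradiction.
  rcases hr0.eq_or_lt with hr0 | hr0
  · have h1 := hv S le_rfl
    have hle : ∀ j, φ j ≤ u - Q := fun j => by
      have : ∑ k, q k * (φ j + χ k) ≤ ∑ k, q k * u :=
        Finset.sum_le_sum fun k _ => mul_le_mul_of_nonneg_left
          (by simpa [hr0] using (hu j k).le) (hq.1 k)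
      rw [← Finset.sum_mul, hq.2] at this
      simp only [mul_add, Finset.sum_add_distrib] at this
      rw [← Finset.sum_mul, hq.2] at this
      linarith
    have : P ≤ ∑ j, p j * (u - Q) :=
      Finset.sum_le_sum fun j _ => mul_le_mul_of_nonneg_left (hle j) (hp.1 j)
    rw [← Finset.sum_mul, hp.2] at this
    simp only [hr0, mul_zero] at h1
    linarith
  · have hρ : 0 < -r := neg_pos.2 hr0
    -- The infimal convolution of `(u - χ) / (-r)` with the distance is 1-Lipschitz on all of `X`,
    -- and trades the pair `φ`, `χ` for a single potential.
    let ψ : X → ℝ := fun x =>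
      Finset.univ.inf' Finset.univ_nonempty fun k => dist x (e k) + (u - χ k) / (-r)
    have hψ : LipschitzWith 1 ψ := LipschitzWith.of_le_add fun x y => by
      obtain ⟨k, -, hk⟩ := Finset.exists_mem_eq_inf' Finset.univ_nonempty
        fun k => dist y (e k) + (u - χ k) / (-r)
      have h1 : ψ x ≤ dist x (e k) + (u - χ k) / (-r) := Finset.inf'_le _ (Finset.mem_univ k)
      have h2 : ψ y = dist y (e k) + (u - χ k) / (-r) := hk
      linarith [dist_triangle x y (e k)]
    have hφψ : ∀ j, φ j ≤ (-r) * ψ (e j) := fun j => by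
      rw [← div_le_iff₀' hρ]
      refine Finset.le_inf' _ _ fun k _ => ?_
      rw [div_le_iff₀' hρ, mul_add, mul_div_cancel₀ _ hρ.ne']
      linarith [hu j k]
    have hχψ : ∀ k, χ k ≤ u - (-r) * ψ (e k) := fun k => by
      have : ψ (e k) ≤ dist (e k) (e k) + (u - χ k) / (-r) :=
        Finset.inf'_le _ (Finset.mem_univ k)
      rw [dist_self, zero_add, le_div_iff₀' hρ] at this
      linarith
    have h1 := mul_le_mul_of_nonneg_left (h ψ hψ) hρ.le
    have h2 : P ≤ ∑ j, p j * ((-r) * ψ (e j)) :=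
      Finset.sum_le_sum fun j _ => mul_le_mul_of_nonneg_left (hφψ j) (hp.1 j)
    have h3 : Q ≤ ∑ j, q j * (u - (-r) * ψ (e j)) :=
      Finset.sum_le_sum fun j _ => mul_le_mul_of_nonneg_left (hχψ j) (hq.1 j)
    simp only [mul_sub, Finset.sum_sub_distrib] at h3
    rw [← Finset.sum_mul, hq.2] at h3
    simp only [mul_sub, Finset.mul_sum] at h1
    simp only [mul_left_comm _ (-r)] at h2 h3
    linarith [hv S le_rfl]

open ProbabilityTheory in
/-- A coupling of the laws of `t` under `μ` and `ν` lifts to a coupling of `μ` and `ν`. -/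
theorem exists_plan_of_coupling {X ι : Type*} [MeasurableSpace X] [Fintype ι]
    [MeasurableSpace ι] [MeasurableSingletonClass ι] (μ ν : Measure X) [IsProbabilityMeasure μ]
    [IsProbabilityMeasure ν] {t : X → ι} (ht : Measurable t) {g : ι × ι → ℝ}
    (hg : ∀ z, 0 ≤ g z) (hμ : ∀ j, ∑ k, g (j, k) = μ.real (t ⁻¹' {j}))
    (hν : ∀ k, ∑ j, g (j, k) = ν.real (t ⁻¹' {k})) :
    ∃ γ : Measure (X × X), γ.map Prod.fst = μ ∧ γ.map Prod.snd = ν ∧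
      ∀ z, γ.real (Prod.map t t ⁻¹' {z}) = g z := by
  classical
  have hm : ∀ j, MeasurableSet (t ⁻¹' {j}) := fun j => ht (measurableSet_singleton j)
  -- Conditioning on a null cell gives the zero measure; `g` vanishes on such cells, so no mass is
  -- lost.
  have hμ0 : ∀ j k, μ (t ⁻¹' {j}) = 0 → g (j, k) = 0 := fun j k h0 => by
    have h1 := hμ j
    rw [measureReal_def, h0, ENNReal.toReal_zero, Finset.sum_eq_zero_iff_of_nonneg
      fun k _ => hg _] at h1
    exact h1 k (Finset.mem_univ k)
  have hν0 : ∀ j k, ν (t ⁻¹' {k}) = 0 → g (j, k) = 0 := fun j k h0 => by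
    have h1 := hν k
    rw [measureReal_def, h0, ENNReal.toReal_zero, Finset.sum_eq_zero_iff_of_nonneg
      fun k _ => hg _] at h1
    exact h1 j (Finset.mem_univ j)
  have hsum : ∀ (m : Measure X) [IsProbabilityMeasure m] (B : Set X), MeasurableSet B →
      ∑ j, m (t ⁻¹' {j}) * m[|t ⁻¹' {j}] B = m B := fun m _ B hB => by
    simp_rw [mul_comm (m _), cond_mul_eq_inter (hm _)]
    rw [← measure_biUnion_finset (f := fun j => t ⁻¹' {j} ∩ B)]
    · congr 1; ext x; simp
    · intro j _ k _ hjk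
      refine Disjoint.mono Set.inter_subset_left Set.inter_subset_left ?_
      exact Disjoint.preimage _ (by simpa using hjk)
    · exact fun j _ => (hm j).inter hB
  -- Each weight `g z` is spread over its product cell by independent conditional laws.
  let γ : Measure (X × X) :=
    ∑ z : ι × ι, ENNReal.ofReal (g z) • (μ[|t ⁻¹' {z.1}]).prod ν[|t ⁻¹' {z.2}]
  have hγ : ∀ B C : Set X, γ (B ×ˢ C) =
      ∑ z : ι × ι, ENNReal.ofReal (g z) * (μ[|t ⁻¹' {z.1}] B * ν[|t ⁻¹' {z.2}] C) :=
    fun B C => by simp [γ, Measure.finsetSum_apply]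
  refine ⟨γ, ?_, ?_, fun z => ?_⟩
  · ext B hB
    rw [Measure.map_apply measurable_fst hB, ← Set.prod_univ, hγ, Fintype.sum_prod_type,
      ← hsum μ B hB]
    refine Finset.sum_congr rfl fun j _ => ?_
    rw [← ofReal_measureReal (s := t ⁻¹' {j}), ← hμ, ENNReal.ofReal_sum_of_nonneg
      fun k _ => hg _, Finset.sum_mul]
    refine Finset.sum_congr rfl fun k _ => ?_
    by_cases h0 : ν (t ⁻¹' {k}) = 0
    · simp [hν0 j k h0]
    · have := cond_isProbabilityMeasure h0
      simp
  · ext C hC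
    rw [Measure.map_apply measurable_snd hC, ← Set.univ_prod, hγ, Fintype.sum_prod_type_right,
      ← hsum ν C hC]
    refine Finset.sum_congr rfl fun k _ => ?_
    rw [← ofReal_measureReal (s := t ⁻¹' {k}), ← hν, ENNReal.ofReal_sum_of_nonneg
      fun k _ => hg _, Finset.sum_mul]
    refine Finset.sum_congr rfl fun j _ => ?_
    by_cases h0 : μ (t ⁻¹' {j}) = 0
    · simp [hμ0 j k h0]
    · have := cond_isProbabilityMeasure h0
      simp
  · have hz : Prod.map t t ⁻¹' {z} = (t ⁻¹' {z.1}) ×ˢ (t ⁻¹' {z.2}) := by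
      ext ⟨x, y⟩; simp [Prod.ext_iff]
    rw [measureReal_def, hz, hγ, Finset.sum_eq_single z]
    · by_cases h1 : μ (t ⁻¹' {z.1}) = 0
      · simp [hμ0 z.1 z.2 h1]
      by_cases h2 : ν (t ⁻¹' {z.2}) = 0
      · simp [hν0 z.1 z.2 h2]
      rw [cond_apply_self h1 (measure_ne_top _ _), cond_apply_self h2 (measure_ne_top _ _)]
      simp [hg z]
    · intro z' _ hz'
      have hd : ∀ (m : Measure X) (a b : ι), a ≠ b → m[|t ⁻¹' {a}] (t ⁻¹' {b}) = 0 := by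
        intro m a b hab
        rw [cond_apply (hm a), (Disjoint.preimage t (by simpa using hab)).inter_eq]
        simp
      by_cases h1 : z'.1 = z.1
      · rw [hd ν _ _ fun h2 => hz' (Prod.ext h1 h2)]; simp
      · rw [hd μ _ _ h1]; simp
    · simp

/-- Kantorovich–Rubinstein duality. -/
theorem W1_le_of_forall_lipschitz {X : Type*} [MetricSpace X] [MeasurableSpace X] [BorelSpace X]
    [SecondCountableTopology X] (μ ν : FiniteFirstMoment X) {S : ℝ}
    (h : ∀ ψ : X → ℝ, LipschitzWith 1 ψ →
      ∫ x, ψ x ∂μ.toMeasure - ∫ x, ψ x ∂ν.toMeasure ≤ S) : W1 μ ν ≤ S := by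
  have := μ.nonempty
  obtain ⟨e, t, ht, hlim⟩ := exists_quantization X
  refine le_of_forall_pos_le_add fun ε hε => ?_
  -- The error `ε / 4` is paid four times: once per marginal in discretizing the hypothesis, once
  -- per marginal in moving the lifted plan to cell representatives.
  obtain ⟨n, hn1, hn2⟩ := (((hlim μ).eventually_lt_const (show 0 < ε / 4 by positivity)).and
    ((hlim ν).eventually_lt_const (show 0 < ε / 4 by positivity))).exists
  have htn := ht n
  generalize t n = s at hn1 hn2 htn
  have hsimplex : ∀ m : Measure X, IsProbabilityMeasure m →
      (fun j => m.real (s ⁻¹' {j})) ∈ stdSimplex ℝ (Fin (n + 1)) := fun m _ =>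
    ⟨fun j => measureReal_nonneg, by
      simpa using (integral_comp_of_fintype m htn fun _ => (1 : ℝ)).symm⟩
  obtain ⟨g, hg, hgμ, hgν, hcost⟩ := exists_coupling_of_forall_lipschitz
    (fun j : Fin (n + 1) => e j) (hsimplex μ.toMeasure inferInstance)
    (hsimplex ν.toMeasure inferInstance) (S := S + ε / 2) (fun ψ hψ => by
      have h1 := abs_le.1 (μ.abs_integral_sub_sum_le htn (fun j => e j) hψ)
      have h2 := abs_le.1 (ν.abs_integral_sub_sum_le htn (fun j => e j) hψ)
      linarith [h ψ hψ, h1.1, h2.2])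
  obtain ⟨γ, hγ1, hγ2, hγg⟩ := exists_plan_of_coupling μ.toMeasure ν.toMeasure htn hg hgμ hgν
  have hprob : IsProbabilityMeasure γ := ⟨by
    rw [← Set.preimage_univ (f := Prod.fst), ← Measure.map_apply measurable_fst .univ, hγ1]
    exact measure_univ⟩
  obtain ⟨γ, rfl⟩ : ∃ γ' : ProbabilityMeasure (X × X), (γ' : Measure (X × X)) = γ :=
    ⟨⟨γ, hprob⟩, rfl⟩
  have hγ : γ ∈ transportPlans μ ν := ⟨hγ1, hγ2⟩
  refine (W1_le_of_mem_transportPlans hγ).trans ?_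
  have hi1 := integrable_comp_fst_of_mem_transportPlans hγ
    (μ.integrable_dist_comp htn fun j => e j)
  have hi2 := integrable_comp_snd_of_mem_transportPlans hγ
    (ν.integrable_dist_comp htn fun j => e j)
  have he1 := integral_comp_fst_of_mem_transportPlans hγ
    (μ.integrable_dist_comp htn fun j => e j)
  have he2 := integral_comp_snd_of_mem_transportPlans hγ
    (ν.integrable_dist_comp htn fun j => e j)
  have hi3 := integrable_comp_of_fintype (γ : Measure (X × X)) (htn.prodMap htn)
    fun z : Fin (n + 1) × Fin (n + 1) => dist (e z.1) (e z.2)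
  have he3 := integral_comp_of_fintype (γ : Measure (X × X)) (htn.prodMap htn)
    fun z : Fin (n + 1) × Fin (n + 1) => dist (e z.1) (e z.2)
  simp_rw [hγg] at he3
  have hle := integral_mono (integrable_dist_of_mem_transportPlans hγ) ((hi1.add hi2).add hi3)
    (fun z => by
      have h1 := dist_triangle4_right z.1 z.2 (e (s z.1)) (e (s z.2))
      simpa using h1)
  simp only [Pi.add_apply] at hle
  rw [integral_add (f := fun z : X × X => dist z.1 (e (s z.1)) + dist z.2 (e (s z.2)))
    (hi1.add hi2) hi3, integral_add hi1 hi2, he1, he2] at hle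
  linarith [he3.trans_le hcost]

/-! ### Support and minimax principles -/

/-- A nonpositive continuous function with vanishing integral vanishes on the support. -/
theorem eq_zero_of_mem_support_of_integral_eq_zero {X : Type*}
    [TopologicalSpace X] [MeasurableSpace X] {μ : Measure X} {f : X → ℝ}
    (hf : Continuous f) (hint : Integrable f μ) (hle : ∀ x, f x ≤ 0) (h0 : ∫ x, f x ∂μ = 0)
    {x : X} (hx : x ∈ μ.support) : f x = 0 := by
  by_contra hne
  have hae : (fun x => -f x) =ᵐ[μ] 0 := by
    rw [← integral_eq_zero_iff_of_nonneg (fun x => neg_nonneg.2 (hle x)) hint.neg,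
      integral_neg, h0, neg_zero]
  have hpos := (Measure.mem_support_iff_forall x).1 hx {y | f y ≠ 0}
    ((isOpen_ne_fun hf continuous_const).mem_nhds hne)
  refine hpos.ne' (measure_mono_null (fun y hy => ?_) hae)
  simpa using hy

/-- Minimax principle: a family of functions that are continuous and affine on a compact convex
set admits a common point where all of them are at least `D`, provided the supremum of each of
their finite convex combinations is at least `D`. -/
theorem exists_forall_le_of_convexCombo {E Y : Type*} [AddCommGroup E] [Module ℝ E]
    [TopologicalSpace E] [T2Space E] {K : Set E} (hK : IsCompact K) (hKconv : Convex ℝ K)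
    (hKne : K.Nonempty) {L : Y → E → ℝ} (hLc : ∀ y, ContinuousOn (L y) K)
    (hL : ∀ y, ∀ u ∈ K, ∀ v ∈ K, ∀ a b : ℝ, 0 ≤ a → 0 ≤ b → a + b = 1 →
      L y (a • u + b • v) = a * L y u + b * L y v) {D : ℝ}
    (hD : ∀ (F : Finset Y) (p : F → ℝ), p ∈ stdSimplex ℝ F → ∀ ε > 0,
      ∃ u ∈ K, D - ε ≤ ∑ y, p y * L y u) :
    ∃ u ∈ K, ∀ y, D ≤ L y u := by
  classical
  -- Compactness reduces to finitely many `y`. Were there no common point, the compact convex image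
  -- of `K` would be separated from the orthant of vectors with all coordinates at least `D`.
  obtain ⟨u, huK, hu⟩ := hK.inter_iInter_nonempty (fun y => K ∩ L y ⁻¹' Set.Ici D)
    (fun y => (hLc y).preimage_isClosed_of_isClosed hK.isClosed isClosed_Ici) (fun F => by
      by_contra hempty
      let Φ : E → F → ℝ := fun u y => L y u
      have hΦc : ContinuousOn Φ K := continuousOn_pi.2 fun y => hLc y
      have hΦconv : Convex ℝ (Φ '' K) := by
        rintro _ ⟨u, hu, rfl⟩ _ ⟨v, hv, rfl⟩ a b ha hb hab
        exact ⟨a • u + b • v, hKconv hu hv ha hb hab, funext fun y =>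
          hL y u hu v hv a b ha hb hab⟩
      obtain ⟨f, s, t, hfs, hst, hft⟩ := geometric_hahn_banach_compact_closed hΦconv
        (hK.image_of_continuousOn hΦc) (convex_Ici fun _ => D) (isClosed_Ici (a := fun _ => D))
        (by
          rw [Set.disjoint_left]
          rintro _ ⟨u, hu, rfl⟩ hge
          refine hempty ⟨u, hu, Set.mem_iInter₂.2 fun y hy => ⟨hu, hge ⟨y, hy⟩⟩⟩)
      set c : F → ℝ := fun y => f (Pi.single y 1) with hc
      have hf : ∀ z : F → ℝ, f z = ∑ y, c y * z y := fun z => by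
        conv_lhs => rw [← Finset.univ_sum_single z]
        rw [map_sum]
        refine Finset.sum_congr rfl fun y _ => ?_
        rw [mul_comm, hc, ← smul_eq_mul, ← map_smul, ← Pi.single_smul, smul_eq_mul, mul_one]
      have hc0 : ∀ y, 0 ≤ c y := fun y => by
        by_contra! hy
        have hM : 0 ≤ |t - f fun _ => D| / (-c y) := div_nonneg (abs_nonneg _) (neg_pos.2 hy).le
        -- The bump lowers `f` by `|t - f D|`, hence to at most `t`, while staying in the orthant.
        have h1 := hft ((fun _ => D) + Pi.single y (|t - f fun _ => D| / (-c y)))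
          (Set.mem_Ici.2 (le_add_of_nonneg_right (Pi.single_nonneg.2 hM)))
        rw [map_add, hf (Pi.single _ _)] at h1
        simp only [Pi.single_apply, mul_ite, mul_zero, Finset.sum_ite_eq', Finset.mem_univ,
          if_true] at h1
        rw [div_neg, mul_neg, mul_div_cancel₀ _ hy.ne] at h1
        linarith [le_abs_self (t - f fun _ => D), neg_abs_le (t - f fun _ => D)]
      have hD' := hft (fun _ => D) (Set.self_mem_Ici)
      obtain ⟨u₀, hu₀⟩ := hKne
      have hC : 0 < ∑ y, c y := by
        refine (Finset.sum_nonneg fun y _ => hc0 y).lt_of_ne' fun h0 => ?_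
        have hz := (Finset.sum_eq_zero_iff_of_nonneg fun y _ => hc0 y).1 h0
        have h1 := hfs _ ⟨u₀, hu₀, rfl⟩
        rw [hf, Finset.sum_eq_zero fun y hy => by rw [hz y hy, zero_mul]] at h1 hD'
        linarith
      set C := ∑ y, c y with hCdef
      rw [hf, ← Finset.sum_mul] at hD'
      -- Normalized, `c / C` is a convex combination staying below `s / C` on `K`, which contradicts
      -- `hD` with `ε = D - s / C`.
      have hsD : s / C < D := by rw [div_lt_iff₀ hC]; linarith
      obtain ⟨u, hu, hle⟩ := hD F (fun y => c y / C)
        ⟨fun y => div_nonneg (hc0 y) hC.le, by rw [← Finset.sum_div, div_self hC.ne']⟩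
        (D - s / C) (sub_pos.2 hsD)
      have h1 := hfs _ ⟨u, hu, rfl⟩
      rw [hf] at h1
      have h2 : ∑ y : F, c y / C * L y u = (∑ y, c y * Φ u y) / C := by
        rw [Finset.sum_div]
        exact Finset.sum_congr rfl fun y _ => by ring
      rw [h2, sub_sub_cancel, div_le_div_iff_of_pos_right hC] at hle
      linarith)
  exact ⟨u, huK, fun y => (Set.mem_iInter.1 hu y).2⟩

/-! ### Compactness of normalized Lipschitz tuples -/

/-- Tuples of 1-Lipschitz functions vanishing at `x₀`. -/
def normalizedLipschitz {X : Type*} [MetricSpace X] (ι : Type*) (x₀ : X) : Set (ι → X → ℝ) :=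
  {ψ | ∀ i, LipschitzWith 1 (ψ i) ∧ ψ i x₀ = 0}

section

variable {X ι : Type*} [MetricSpace X] (x₀ : X)

theorem convex_normalizedLipschitz : Convex ℝ (normalizedLipschitz ι x₀) := by
  intro φ hφ ψ hψ a b ha hb hab i
  refine ⟨LipschitzWith.of_le_add fun x y => ?_, by simp [(hφ i).2, (hψ i).2]⟩
  have h1 : φ i x ≤ φ i y + dist x y := by simpa using (hφ i).1.le_add_mul x y
  have h2 : ψ i x ≤ ψ i y + dist x y := by simpa using (hψ i).1.le_add_mul x y
  simp only [Pi.add_apply, Pi.smul_apply, smul_eq_mul]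
  calc a * φ i x + b * ψ i x ≤ a * (φ i y + dist x y) + b * (ψ i y + dist x y) := by gcongr
    _ = a * φ i y + b * ψ i y + (a + b) * dist x y := by ring
    _ = _ := by rw [hab, one_mul]

/-- By Tychonoff: `|ψ i x| ≤ dist x x₀` confines the tuples to a product of intervals, and the
defining conditions are closed pointwise. -/
theorem isCompact_normalizedLipschitz : IsCompact (normalizedLipschitz ι x₀) := by
  refine (isCompact_univ_pi fun _ : ι => isCompact_univ_pi fun x : X =>
    isCompact_Icc (a := -dist x x₀) (b := dist x x₀)).of_isClosed_subset ?_ fun ψ hψ i _ x _ => ?_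
  · have : normalizedLipschitz ι x₀ = {ψ | ∀ i, (∀ x y, ψ i x ≤ ψ i y + dist x y) ∧
        ψ i x₀ = 0} := by
      ext ψ
      refine forall_congr' fun i => and_congr_left fun _ => ⟨fun h x y => ?_, .of_le_add⟩
      simpa using h.le_add_mul x y
    rw [this]
    simp only [Set.ofPred_forall, Set.ofPred_and]
    refine isClosed_iInter fun i => .inter (isClosed_iInter fun x => isClosed_iInter fun y => ?_) ?_
    · exact isClosed_le (by fun_prop) (by fun_prop)
    · exact isClosed_eq (by fun_prop) (by fun_prop)
  · have h := (hψ i).1.dist_le_mul x x₀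
    rwa [(hψ i).2, NNReal.coe_one, one_mul, dist_zero_right, Real.norm_eq_abs, abs_le] at h

/-- Dominated convergence does not apply to nets; instead the integral is a uniform limit of finite
combinations of point evaluations. -/
theorem continuousOn_integral_normalizedLipschitz [MeasurableSpace X] [BorelSpace X]
    [SecondCountableTopology X] (μ : FiniteFirstMoment X) (i : ι) :
    ContinuousOn (fun ψ : ι → X → ℝ => ∫ x, ψ i x ∂μ.toMeasure) (normalizedLipschitz ι x₀) := by
  have : Nonempty X := ⟨x₀⟩
  obtain ⟨e, t, ht, hlim⟩ := exists_quantization X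
  have hunif : TendstoUniformlyOn (fun n (ψ : ι → X → ℝ) =>
      ∑ j, μ.toMeasure.real (t n ⁻¹' {j}) * ψ i (e j)) (fun ψ => ∫ x, ψ i x ∂μ.toMeasure)
      Filter.atTop (normalizedLipschitz ι x₀) := by
    rw [Metric.tendstoUniformlyOn_iff]
    intro ε hε
    filter_upwards [(hlim μ).eventually_lt_const hε] with n hn ψ hψ
    exact (μ.abs_integral_sub_sum_le (ht n) (fun j => e j) (hψ i).1).trans_lt hn
  refine hunif.continuousOn (Filter.Frequently.of_forall fun n => Continuous.continuousOn ?_)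
  fun_prop

end

/-! ### Dual potentials and optimality conditions -/

section

variable {X : Type*} [MetricSpace X] [MeasurableSpace X] [BorelSpace X]

/-- Finite convex combinations of Dirac masses. -/
theorem exists_finiteFirstMoment_integral_eq_sum (F : Finset X) {p : F → ℝ}
    (hp : p ∈ stdSimplex ℝ F) : ∃ μ : FiniteFirstMoment X,
      ∀ f : X → ℝ, ∫ x, f x ∂μ.toMeasure = ∑ y, p y * f y := by
  let m : Measure X := ∑ y, ENNReal.ofReal (p y) • Measure.dirac (y : X)
  have hint : ∀ (f : X → ℝ) (y : F),
      Integrable f (ENNReal.ofReal (p y) • Measure.dirac (y : X)) := fun f y =>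
    (integrable_dirac enorm_lt_top).smul_measure ENNReal.ofReal_ne_top
  have hm : IsProbabilityMeasure m := ⟨by
    simp only [m, Measure.finsetSum_apply, Measure.smul_apply, measure_univ, smul_eq_mul, mul_one]
    rw [← ENNReal.ofReal_sum_of_nonneg fun y _ => hp.1 y, hp.2, ENNReal.ofReal_one]⟩
  have hne : Nonempty X := by
    by_contra hX
    rw [not_nonempty_iff] at hX
    simpa using hp.2
  obtain ⟨x₀⟩ := hne
  refine ⟨⟨⟨m, hm⟩, x₀, integrable_finsetSum_measure.2 fun y _ => hint _ y⟩, fun f => ?_⟩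
  change ∫ x, f x ∂m = _
  rw [integral_finsetSum_measure fun y _ => hint f y]
  refine Finset.sum_congr rfl fun y _ => ?_
  rw [integral_smul_measure, integral_dirac, ENNReal.toReal_ofReal (hp.1 y), smul_eq_mul]

theorem FiniteFirstMoment.integral_sum_mul {N : ℕ} (μ : FiniteFirstMoment X) (w : Fin N → ℝ)
    {ψ : Fin N → X → ℝ} (hψ : ∀ i, LipschitzWith 1 (ψ i)) :
    ∫ x, ∑ i, w i * ψ i x ∂μ.toMeasure = ∑ i, w i * ∫ x, ψ i x ∂μ.toMeasure := by
  rw [integral_finsetSum _ fun i _ => (μ.integrable_of_lipschitz (hψ i)).const_mul (w i)]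
  simp_rw [integral_const_mul]

variable [SecondCountableTopology X]

/-- Optimal dual potentials for the median problem. -/
theorem exists_dual_potentials_of_mem_medians {N : ℕ} {ν : Fin N → FiniteFirstMoment X}
    {w : Fin N → ℝ} (hw : w ∈ stdSimplex ℝ (Fin N)) {ν₀ : FiniteFirstMoment X}
    (hν₀ : ν₀ ∈ medians w ν) :
    ∃ ψ : Fin N → X → ℝ, (∀ i, LipschitzWith 1 (ψ i)) ∧ (∀ x, ∑ i, w i * ψ i x ≤ 0) ∧
      dispersion w ν ν₀ ≤ ∑ i, w i * ∫ x, ψ i x ∂(ν i).toMeasure := by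
  obtain ⟨x₀⟩ := ν₀.nonempty
  obtain ⟨φ, hφ, hle⟩ := exists_forall_le_of_convexCombo
    (isCompact_normalizedLipschitz (ι := Fin N) x₀) (convex_normalizedLipschitz x₀)
    ⟨0, fun i => ⟨LipschitzWith.const' 0, rfl⟩⟩
    (L := fun (x : X) ψ => ∑ i, w i * (∫ z, ψ i z ∂(ν i).toMeasure - ψ i x))
    (D := dispersion w ν ν₀)
    (fun x => continuousOn_finsetSum _ fun i _ => continuousOn_const.mul
      ((continuousOn_integral_normalizedLipschitz x₀ (ν i) i).sub
        (Continuous.continuousOn (by fun_prop))))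
    (fun x u hu v hv a b _ _ _ => by
      rw [Finset.mul_sum, Finset.mul_sum, ← Finset.sum_add_distrib]
      refine Finset.sum_congr rfl fun i _ => ?_
      have h1 := ((ν i).integrable_of_lipschitz (hu i).1).const_mul a
      have h2 := ((ν i).integrable_of_lipschitz (hv i).1).const_mul b
      simp only [Pi.add_apply, Pi.smul_apply, smul_eq_mul]
      rw [integral_add h1 h2, integral_const_mul, integral_const_mul]
      ring)
    -- Averaging `L` with weights `p` gives the dual objective at `μ = ∑ p y δ_y`. Near-optimal
    -- potentials for each `W1 (ν i) μ` and minimality of `ν₀` bound it below; subtracting `ψ i x₀`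
    -- leaves `L` unchanged.
    (fun F p hp ε hε => by
      obtain ⟨μ, hμ⟩ := exists_finiteFirstMoment_integral_eq_sum F hp
      have hex : ∀ i, ∃ ψ : X → ℝ, LipschitzWith 1 ψ ∧ W1 (ν i) μ - ε <
          ∫ x, ψ x ∂(ν i).toMeasure - ∫ x, ψ x ∂μ.toMeasure := fun i => by
        by_contra! hcon
        linarith [W1_le_of_forall_lipschitz (ν i) μ hcon]
      choose ψ hψ hlt using hex
      refine ⟨fun i x => ψ i x - ψ i x₀, fun i => ⟨?_, sub_self _⟩, ?_⟩
      · simpa using (hψ i).sub (LipschitzWith.const (ψ i x₀))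
      · have hswap : ∑ y, p y * ∑ i, w i * (∫ z, ψ i z - ψ i x₀ ∂(ν i).toMeasure -
            (ψ i y - ψ i x₀)) = ∑ i, w i * (∫ x, ψ i x ∂(ν i).toMeasure -
              ∫ x, ψ i x ∂μ.toMeasure) := by
          simp_rw [Finset.mul_sum]
          rw [Finset.sum_comm]
          refine Finset.sum_congr rfl fun i _ => ?_
          rw [hμ, integral_sub ((ν i).integrable_of_lipschitz (hψ i)) (integrable_const _),
            integral_const, probReal_univ, one_smul]
          simp_rw [mul_left_comm _ (w i), ← Finset.mul_sum, sub_sub_sub_cancel_right, mul_sub,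
            Finset.sum_sub_distrib, ← Finset.sum_mul]
          rw [hp.2, one_mul, mul_sub]
        rw [hswap]
        calc dispersion w ν ν₀ - ε ≤ dispersion w ν μ - ε := by linarith [hν₀ μ]
          _ = ∑ i, w i * (W1 (ν i) μ - ε) := by
            simp_rw [mul_sub, Finset.sum_sub_distrib, ← Finset.sum_mul]
            rw [hw.2, one_mul, dispersion]
          _ ≤ _ := Finset.sum_le_sum fun i _ => mul_le_mul_of_nonneg_left (hlt i).le (hw.1 i))
  -- `hle` says `∑ i, w i * φ i x ≤ c`. As the weights sum to one, shifting every potential by `c`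
  -- makes this sum nonpositive and the dual value exactly the dispersion of `ν₀`.
  set c := ∑ i, w i * ∫ z, φ i z ∂(ν i).toMeasure - dispersion w ν ν₀ with hc
  refine ⟨fun i x => φ i x - c, fun i => ?_, fun x => ?_, le_of_eq ?_⟩
  · simpa using (hφ i).1.sub (LipschitzWith.const c)
  · have := hle x
    simp only [mul_sub, Finset.sum_sub_distrib] at this ⊢
    rw [← Finset.sum_mul, hw.2]
    linarith
  · have : ∀ i, ∫ x, φ i x - c ∂(ν i).toMeasure = ∫ x, φ i x ∂(ν i).toMeasure - c := fun i => by
      rw [integral_sub ((ν i).integrable_of_lipschitz (hφ i).1) (integrable_const _),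
        integral_const, probReal_univ, one_smul]
    simp_rw [this, mul_sub, Finset.sum_sub_distrib]
    rw [← Finset.sum_mul, hw.2, hc]
    ring

theorem mem_medians_iff {N : ℕ} (ν : Fin N → FiniteFirstMoment X) {w : Fin N → ℝ}
    (hw : w ∈ stdSimplex ℝ (Fin N)) (hpos : ∀ i, 0 < w i) (ν₀ : FiniteFirstMoment X) :
    ν₀ ∈ medians w ν ↔
      ∃ ψ : Fin N → X → ℝ, (∀ i, IsKantorovichPotential (ψ i) (ν i) ν₀) ∧
        (∀ x : X, ∑ i, w i * ψ i x ≤ 0) ∧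
        (∀ x ∈ ν₀.toMeasure.support, ∑ i, w i * ψ i x = 0) := by
  constructor
  · intro hν₀
    obtain ⟨ψ, hψ, hle, hD⟩ := exists_dual_potentials_of_mem_medians hw hν₀
    have hgap : ∀ i, 0 ≤ w i * (W1 (ν i) ν₀ -
        (∫ x, ψ i x ∂(ν i).toMeasure - ∫ x, ψ i x ∂ν₀.toMeasure)) := fun i =>
      mul_nonneg (hw.1 i) (sub_nonneg.2 (integral_sub_integral_le_W1 _ _ (hψ i)))
    -- The nonnegative duality gaps add up to two nonpositive terms, so each gap vanishes and so
    -- does the integral of `∑ i, w i * ψ i` against `ν₀`.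
    have hsum : ∑ i, w i * (W1 (ν i) ν₀ -
        (∫ x, ψ i x ∂(ν i).toMeasure - ∫ x, ψ i x ∂ν₀.toMeasure)) =
        dispersion w ν ν₀ - ∑ i, w i * ∫ x, ψ i x ∂(ν i).toMeasure +
          ∫ x, ∑ i, w i * ψ i x ∂ν₀.toMeasure := by
      rw [ν₀.integral_sum_mul w hψ, dispersion, ← Finset.sum_sub_distrib,
        ← Finset.sum_add_distrib]
      exact Finset.sum_congr rfl fun i _ => by ring
    have hint : ∫ x, ∑ i, w i * ψ i x ∂ν₀.toMeasure ≤ 0 := integral_nonpos hle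
    have hsum0 := Finset.sum_nonneg fun i (_ : i ∈ Finset.univ) => hgap i
    refine ⟨ψ, fun i => ⟨hψ i, ?_⟩, hle, fun x hx => ?_⟩
    · have h0 := (Finset.sum_eq_zero_iff_of_nonneg fun i _ => hgap i).1
        (le_antisymm (by linarith) hsum0) i (Finset.mem_univ i)
      exact sub_eq_zero.1 ((mul_eq_zero.1 h0).resolve_left (hpos i).ne')
    · refine eq_zero_of_mem_support_of_integral_eq_zero (f := fun x => ∑ i, w i * ψ i x)
        (continuous_finsetSum _ fun i _ => continuous_const.mul (hψ i).continuous)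
        (integrable_finsetSum _ fun i _ => (ν₀.integrable_of_lipschitz (hψ i)).const_mul _)
        hle (le_antisymm hint (by linarith)) hx
  · rintro ⟨ψ, hψ, hle, hzero⟩ μ
    have hν₀ : ∫ x, ∑ i, w i * ψ i x ∂ν₀.toMeasure = 0 :=
      integral_eq_zero_of_ae (Filter.mem_of_superset Measure.support_mem_ae hzero)
    have hμ : ∫ x, ∑ i, w i * ψ i x ∂μ.toMeasure ≤ 0 := integral_nonpos hle
    rw [FiniteFirstMoment.integral_sum_mul _ w fun i => (hψ i).1] at hν₀ hμ
    calc dispersion w ν ν₀ = ∑ i, w i * ∫ x, ψ i x ∂(ν i).toMeasure := by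
          simp_rw [dispersion, (hψ _).2, mul_sub, Finset.sum_sub_distrib, hν₀, sub_zero]
      _ ≤ ∑ i, w i * (∫ x, ψ i x ∂(ν i).toMeasure - ∫ x, ψ i x ∂μ.toMeasure) := by
          simp_rw [mul_sub, Finset.sum_sub_distrib]
          linarith
      _ ≤ dispersion w ν μ := Finset.sum_le_sum fun i _ => mul_le_mul_of_nonneg_left
          (integral_sub_integral_le_W1 _ _ (hψ i).1) (hw.1 i)

end

end WassersteinMedian

theorem mainTheorem9 {X : Type*} [MetricSpace X] [ProperSpace X] [MeasurableSpace X]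
    [BorelSpace X] (N : ℕ) (ν : Fin N → WassersteinMedian.FiniteFirstMoment X)
    (w : Fin N → ℝ) (hw : w ∈ stdSimplex ℝ (Fin N)) (hpos : ∀ i, 0 < w i)
    (ν₀ : WassersteinMedian.FiniteFirstMoment X) :
    ν₀ ∈ WassersteinMedian.medians w ν ↔
      ∃ ψ : Fin N → X → ℝ,
        (∀ i, WassersteinMedian.IsKantorovichPotential (ψ i) (ν i) ν₀) ∧
        (∀ x : X, ∑ i, w i * ψ i x ≤ 0) ∧
        (∀ x ∈ ν₀.toMeasure.support, ∑ i, w i * ψ i x = 0) :=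
  WassersteinMedian.mem_medians_iff ν hw hpos ν₀
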